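/- Let $\mathbb{H}$ be the real quaternions, with conjugation $q\mapsto\overline q$ and norm $|q|$; let $\mathrm{Im}(\mathbb{H})=\{q : \overline q=-q\}$ and $\mathbb{S}=\{q\in \mathrm{Im}(\mathbb{H}) : |q|=1\}$. Let $\mathsf{H}\neq\{0\}$ be a quaternionic Hilbert space, i.e. a right $\mathbb{H}$-module with an $\mathbb{H}$-valued scalar product $\langle u|v\rangle$ that is right $\mathbb{H}$-linear in $v$, satisfies $\langle u|v\rangle=\overline{\langle v|u\rangle}$, is positive definite, and is complete for the norm $\|u\|=\sqrt{\langle u|u\rangle}$. An operator $T:D(T)\to\mathsf{H}$ is a right $\mathbb{H}$-linear map on a right $\mathbb{H}$-linear subspace $D(T)\subset\mathsf{H}$; $\mathfrak{B}(\mathsf{H})$ is the set of bounded operators with $D(T)=\mathsf{H}$. Compositions are taken on their natural domains. If $D(T)$ is dense, the adjoint $T^*$ has domain $\{u : \exists w\ \forall v\in D(T),\ \langle w|v\rangle=\langle u|Tv\rangle\}$ and $T^*u=w$. $T$ is self-adjoint if $T=T^*$, anti self-adjoint if $T=-T^*$ (equality of domains included), normal if $T\in\mathfrak{B}(\mathsf{H})$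 and $TT^*=T^*T$, unitary if $D(T)=\mathsf{H}$ and $TT^*=T^*T=I$. For $q\in\mathbb{H}$ let $\Delta_q(T)=T^2-T(q+\overline q)+I|q|^2$ on $D(T^2)$, where real scalars act by right multiplication. The spherical resolvent set $\rho_S(T)$ is the set of $q$ such that $\mathrm{Ker}\,\Delta_q(T)=\{0\}$, $\mathrm{Ran}\,\Delta_q(T)$ is dense, and $\Delta_q(T)^{-1}:\mathrm{Ran}\,\Delta_q(T)\to D(T^2)$ is bounded; the spherical spectrum is $\sigma_S(T)=\mathbb{H}\setminus\rho_S(T)$. It is the disjoint union of the point spectrum $\sigma_{pS}(T)$, where $\mathrm{Ker}\,\Delta_q(T)\ne\{0\}$; the residual spectrum $\sigma_{rS}(T)$, where the kernel is $\{0\}$ and the range is not dense; and the continuous spectrum $\sigma_{cS}(T)$, where the kernel is $\{0\}$, the range is dense and $\Delta_q(T)^{-1}$ is not bounded. **Theorem.** Let $T:D(T)\to\mathsf{H}$ be an operator with dense domain. (a) If $T\in\mathfrak{B}(\mathsf{H})$ is normal, then (i) $\sigma_{pS}(T)=\sigma_{pS}(T^*)$; (ii) $\sigma_{rS}(T)=\sigma_{rS}(T^*)=\emptyset$;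 (iii) $\sigma_{cS}(T)=\sigma_{cS}(T^*)$. (b) If $T$ is self-adjoint (not necessarily in $\mathfrak{B}(\mathsf{H})$), then $\sigma_S(T)\subset\mathbb{R}$ and $\sigma_{rS}(T)=\emptyset$. (c) If $T$ is anti self-adjoint (not necessarily in $\mathfrak{B}(\mathsf{H})$), then $\sigma_S(T)\subset\mathrm{Im}(\mathbb{H})$ and $\sigma_{rS}(T)=\emptyset$. (d) If $T\in\mathfrak{B}(\mathsf{H})$ is unitary, then $\sigma_S(T)\subset\{q\in\mathbb{H} : |q|=1\}$. (e) If $T\in\mathfrak{B}(\mathsf{H})$ is anti self-adjoint and unitary, then $\sigma_S(T)=\sigma_{pS}(T)=\mathbb{S}$. -/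

import Mathlib

open scoped Quaternion

/-- A Hermitean quaternionic scalar product on a right `ℍ`-module `H` (a module over `ℍᵐᵒᵖ`, with
`u q = MulOpposite.op q • u`), inducing the norm of `H`. The last field says that `⟪u, u⟫` is the
non-negative real number `‖u‖ ^ 2`; positivity and definiteness are contained in it.
A quaternionic Hilbert space is a complete space of this kind. -/
class QuaternionicInnerProductSpace (H : Type*) [NormedAddCommGroup H] [Module ℍᵐᵒᵖ H]
    extends Inner ℍ H where
  inner_add_right : ∀ u v w : H, inner u (v + w) = inner u v + inner u w
  inner_smul_right : ∀ (u v : H) (q : ℍ), inner u (MulOpposite.op q • v) = inner u v * q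
  star_inner : ∀ u v : H, star (inner v u) = inner u v
  inner_self : ∀ u : H, inner u u = ((‖u‖ ^ 2 : ℝ) : ℍ)

namespace QuatOp

section Quaternions

/-- The imaginary quaternions. -/
def imaginary : Set ℍ := {q | q = q.im}

/-- The real quaternions. -/
def real : Set ℍ := Set.range ((↑) : ℝ → ℍ)

/-- The sphere of unit imaginary quaternions. -/
def unitSphere : Set ℍ := {q | q ∈ imaginary ∧ ‖q‖ = 1}

/-- `q + star q` is real, hence central. -/
theorem add_star_comm (q p : ℍ) : p * (q + star q) = (q + star q) * p := by
  have h : q + star q = ((2 * q.re : ℝ) : ℍ) := by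
    rw [Quaternion.self_add_star']
  rw [h]
  exact (Quaternion.coe_commutes _ _).symm

end Quaternions

variable {H : Type*} [NormedAddCommGroup H] [Module ℍᵐᵒᵖ H]

/-- The identity operator on all of `H`. -/
noncomputable def one : H →ₗ.[ℍᵐᵒᵖ] H := LinearMap.id.toPMap ⊤

/-- The composition `S T` on its natural domain `{x ∈ D(T) | T x ∈ D(S)}`. -/
noncomputable def mul (S T : H →ₗ.[ℍᵐᵒᵖ] H) : H →ₗ.[ℍᵐᵒᵖ] H where
  domain :=
    { carrier := {x | ∃ hx : x ∈ T.domain, T ⟨x, hx⟩ ∈ S.domain}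
      zero_mem' := ⟨T.domain.zero_mem, by
        have h : T ⟨0, T.domain.zero_mem⟩ = 0 := T.map_zero
        rw [h]; exact S.domain.zero_mem⟩
      add_mem' := by
        rintro x y ⟨hx, hx'⟩ ⟨hy, hy'⟩
        refine ⟨T.domain.add_mem hx hy, ?_⟩
        have h : T ⟨x + y, T.domain.add_mem hx hy⟩ = T ⟨x, hx⟩ + T ⟨y, hy⟩ :=
          T.map_add ⟨x, hx⟩ ⟨y, hy⟩
        rw [h]; exact S.domain.add_mem hx' hy'
      smul_mem' := by
        rintro c x ⟨hx, hx'⟩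
        refine ⟨T.domain.smul_mem c hx, ?_⟩
        have h : T ⟨c • x, T.domain.smul_mem c hx⟩ = c • T ⟨x, hx⟩ := T.map_smul c ⟨x, hx⟩
        rw [h]; exact S.domain.smul_mem c hx' }
  toFun :=
    { toFun := fun x => S ⟨T ⟨x.1, x.2.1⟩, x.2.2⟩
      map_add' := by
        rintro ⟨x, hx, hx'⟩ ⟨y, hy, hy'⟩
        rw [← S.map_add]
        congr 1
        exact Subtype.ext (T.map_add ⟨x, hx⟩ ⟨y, hy⟩)
      map_smul' := by
        rintro c ⟨x, hx, hx'⟩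
        rw [RingHom.id_apply, ← S.map_smul]
        congr 1
        exact Subtype.ext (T.map_smul c ⟨x, hx⟩) }

/-- The operator `Δ_q(T) = T² - T (q + q̄) + I |q|²` on `D(T²)`. -/
noncomputable def delta (T : H →ₗ.[ℍᵐᵒᵖ] H) (q : ℍ) : H →ₗ.[ℍᵐᵒᵖ] H where
  domain := (mul T T).domain
  toFun :=
    { toFun := fun x => mul T T x - MulOpposite.op (q + star q) • T ⟨x.1, x.2.1⟩
        + MulOpposite.op ((‖q‖ ^ 2 : ℝ) : ℍ) • x.1
      map_add' := by
        rintro ⟨x, hx, hx'⟩ ⟨y, hy, hy'⟩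
        have h : T ⟨x + y, T.domain.add_mem hx hy⟩ = T ⟨x, hx⟩ + T ⟨y, hy⟩ :=
          T.map_add ⟨x, hx⟩ ⟨y, hy⟩
        rw [LinearPMap.map_add]
        change _ - _ • T ⟨x + y, T.domain.add_mem hx hy⟩ + _ • (x + y) = _
        rw [h, smul_add, smul_add]
        abel
      map_smul' := by
        rintro c ⟨x, hx, hx'⟩
        have h : T ⟨c • x, T.domain.smul_mem c hx⟩ = c • T ⟨x, hx⟩ := T.map_smul c ⟨x, hx⟩
        have h₁ : MulOpposite.op (q + star q) * c = c * MulOpposite.op (q + star q) :=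
          MulOpposite.unop_injective (add_star_comm q c.unop)
        have h₂ : MulOpposite.op ((‖q‖ ^ 2 : ℝ) : ℍ) * c
            = c * MulOpposite.op ((‖q‖ ^ 2 : ℝ) : ℍ) :=
          MulOpposite.unop_injective (Quaternion.coe_commutes _ _).symm
        rw [LinearPMap.map_smul]
        change _ - _ • T ⟨c • x, T.domain.smul_mem c hx⟩ + _ • (c • x) = _
        rw [h, smul_smul, smul_smul, h₁, h₂, RingHom.id_apply, smul_add, smul_sub, smul_smul,
          smul_smul] }

/-- Boundedness of an operator on its own domain. -/
def IsBdd (T : H →ₗ.[ℍᵐᵒᵖ] H) : Prop := ∃ K : ℝ, ∀ u : T.domain, ‖T u‖ ≤ K * ‖(u : H)‖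

/-- `𝔅(H)`: the bounded operators defined on all of `H`. -/
def boundedOperators (H : Type*) [NormedAddCommGroup H] [Module ℍᵐᵒᵖ H] :
    Set (H →ₗ.[ℍᵐᵒᵖ] H) := {T | T.domain = ⊤ ∧ IsBdd T}

/-- The kernel of an operator, as a subspace of its domain. -/
noncomputable def ker (T : H →ₗ.[ℍᵐᵒᵖ] H) : Submodule ℍᵐᵒᵖ T.domain := LinearMap.ker T.toFun

/-- The range of an operator. -/
noncomputable def ran (T : H →ₗ.[ℍᵐᵒᵖ] H) : Submodule ℍᵐᵒᵖ H := LinearMap.range T.toFun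

/-- The spherical resolvent set. -/
noncomputable def resolventSet (T : H →ₗ.[ℍᵐᵒᵖ] H) : Set ℍ :=
  {q | ker (delta T q) = ⊥ ∧ Dense (ran (delta T q) : Set H) ∧ IsBdd (delta T q).inverse}

/-- The spherical spectrum. -/
noncomputable def spectrum (T : H →ₗ.[ℍᵐᵒᵖ] H) : Set ℍ := (resolventSet T)ᶜ

/-- The spherical point spectrum. -/
def pointSpectrum (T : H →ₗ.[ℍᵐᵒᵖ] H) : Set ℍ := {q | ker (delta T q) ≠ ⊥}

/-- The spherical residual spectrum. -/
def residualSpectrum (T : H →ₗ.[ℍᵐᵒᵖ] H) : Set ℍ :=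
  {q | ker (delta T q) = ⊥ ∧ closure (ran (delta T q) : Set H) ≠ Set.univ}

/-- The spherical continuous spectrum. -/
def continuousSpectrum (T : H →ₗ.[ℍᵐᵒᵖ] H) : Set ℍ :=
  {q | ker (delta T q) = ⊥ ∧ closure (ran (delta T q) : Set H) = Set.univ ∧
    ¬ IsBdd (delta T q).inverse}

section Adjoint

variable [QuaternionicInnerProductSpace H]

theorem inner_zero_right (u : H) : inner ℍ u (0 : H) = 0 := by
  have h := QuaternionicInnerProductSpace.inner_add_right u 0 0
  rw [add_zero] at h
  exact left_eq_add.mp h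

theorem inner_add_left (u v w : H) : inner ℍ (u + v) w = inner ℍ u w + inner ℍ v w := by
  rw [← QuaternionicInnerProductSpace.star_inner (u + v) w,
    QuaternionicInnerProductSpace.inner_add_right, star_add,
    QuaternionicInnerProductSpace.star_inner, QuaternionicInnerProductSpace.star_inner]

theorem inner_smul_left (u v : H) (q : ℍ) :
    inner ℍ (MulOpposite.op q • u) v = star q * inner ℍ u v := by
  rw [← QuaternionicInnerProductSpace.star_inner _ v,
    QuaternionicInnerProductSpace.inner_smul_right, star_mul,
    QuaternionicInnerProductSpace.star_inner]

/-- A vector orthogonal to a dense set vanishes. -/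
theorem eq_zero_of_dense {s : Set H} (hs : Dense s) {z : H} (hz : ∀ v ∈ s, inner ℍ z v = 0) :
    z = 0 := by
  by_contra hne
  obtain ⟨v, hv, hdist⟩ := hs.exists_dist_lt z (norm_pos_iff.mpr hne)
  obtain ⟨w, rfl⟩ : ∃ w, v = z + w := ⟨v - z, by abel⟩
  have h0 := hz _ hv
  have h1 : inner ℍ (z + w) z = 0 := by
    rw [← QuaternionicInnerProductSpace.star_inner, h0, star_zero]
  have e1 : inner ℍ z w = -((‖z‖ ^ 2 : ℝ) : ℍ) := by
    rw [QuaternionicInnerProductSpace.inner_add_right,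
      QuaternionicInnerProductSpace.inner_self] at h0
    exact eq_neg_of_add_eq_zero_right h0
  have e2 : inner ℍ w z = -((‖z‖ ^ 2 : ℝ) : ℍ) := by
    rw [inner_add_left, QuaternionicInnerProductSpace.inner_self] at h1
    exact eq_neg_of_add_eq_zero_right h1
  have h2 := QuaternionicInnerProductSpace.inner_self (z + w)
  rw [inner_add_left, QuaternionicInnerProductSpace.inner_add_right,
    QuaternionicInnerProductSpace.inner_add_right, e1, e2,
    QuaternionicInnerProductSpace.inner_self, QuaternionicInnerProductSpace.inner_self] at h2
  have h3 : ‖z‖ ^ 2 + -‖z‖ ^ 2 + (-‖z‖ ^ 2 + ‖w‖ ^ 2) = ‖z + w‖ ^ 2 := by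
    refine Quaternion.coe_injective ?_
    simpa only [Quaternion.coe_add, Quaternion.coe_neg] using h2
  have h4 : ‖w‖ < ‖z‖ := by simpa [dist_eq_norm] using hdist
  nlinarith [norm_nonneg w, norm_nonneg z, sq_nonneg ‖z + w‖]

/-- The pairs `(u, w)` with `⟪w, v⟫ = ⟪u, T v⟫` for all `v ∈ D(T)`. -/
def adjointGraph (T : H →ₗ.[ℍᵐᵒᵖ] H) : Submodule ℍᵐᵒᵖ (H × H) where
  carrier := {p | ∀ v : T.domain, inner ℍ p.2 (v : H) = inner ℍ p.1 (T v)}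
  zero_mem' := by
    intro v
    rw [← QuaternionicInnerProductSpace.star_inner,
      ← QuaternionicInnerProductSpace.star_inner (0 : H × H).1]
    simp only [Prod.fst_zero, Prod.snd_zero, inner_zero_right]
  add_mem' := by
    intro p r hp hr v
    simp only [Prod.fst_add, Prod.snd_add, inner_add_left, hp v, hr v]
  smul_mem' := by
    intro c p hp v
    have h := hp v
    simp only [Prod.smul_fst, Prod.smul_snd]
    rw [← MulOpposite.op_unop c, inner_smul_left, inner_smul_left, h]

/-- The adjoint `T*` of a densely defined operator: the operator whose graph is `adjointGraph T`. -/
noncomputable def adjoint (T : H →ₗ.[ℍᵐᵒᵖ] H) : H →ₗ.[ℍᵐᵒᵖ] H := (adjointGraph T).toLinearPMap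

theorem mem_adjoint_domain (T : H →ₗ.[ℍᵐᵒᵖ] H) (u : H) :
    u ∈ (adjoint T).domain ↔ ∃ w : H, ∀ v : T.domain, inner ℍ w (v : H) = inner ℍ u (T v) := by
  simp [adjoint, Submodule.toLinearPMap_domain, adjointGraph]

theorem inner_adjoint (T : H →ₗ.[ℍᵐᵒᵖ] H) (hT : Dense (T.domain : Set H))
    (u : (adjoint T).domain) (v : T.domain) :
    inner ℍ (adjoint T u) (v : H) = inner ℍ (u : H) (T v) := by
  refine Submodule.mem_graph_toLinearPMap (g := adjointGraph T) ?_ u v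
  rintro ⟨x, y⟩ hxy (rfl : x = 0)
  refine eq_zero_of_dense hT fun v hv => ?_
  have h := hxy ⟨v, hv⟩
  rw [← QuaternionicInnerProductSpace.star_inner (0 : H), inner_zero_right, star_zero] at h
  exact h

/-- `T = T*`. -/
def IsSelfAdjoint (T : H →ₗ.[ℍᵐᵒᵖ] H) : Prop := T = adjoint T

/-- `T = -T*`. -/
def IsAntiSelfAdjoint (T : H →ₗ.[ℍᵐᵒᵖ] H) : Prop := T = -adjoint T

/-- `T ∈ 𝔅(H)` and `T T* = T* T`. -/
def IsNormal (T : H →ₗ.[ℍᵐᵒᵖ] H) : Prop :=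
  T ∈ boundedOperators H ∧ mul T (adjoint T) = mul (adjoint T) T

/-- `D(T) = H` and `T T* = T* T = I`. -/
def IsUnitary (T : H →ₗ.[ℍᵐᵒᵖ] H) : Prop :=
  T.domain = ⊤ ∧ mul T (adjoint T) = one ∧ mul (adjoint T) T = one

end Adjoint

end QuatOp

/-! The coefficients of `Δ_q(T)` are the real numbers `2 Re q` and `‖q‖²`, and the real inner
product `Re ⟪u, v⟫` gives the same norm and the same adjoints. So the problem becomes one about a
real Hilbert space and the quadratic polynomials `T² - 2aT + c`. Operators are handled through their
graphs, which turns natural domains into existential statements.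

Once the residual spectrum is empty, a lower bound for `Δ_q(T)` puts `q` in the resolvent set.
Emptiness comes from the orthogonal complement of the range being the kernel of the formal adjoint
polynomial. If `T` is unbounded this needs a surjective polynomial with the same linear term
(`IsSymmGraph.quad_zero_of_orthogonal`), supplied by von Neumann's projection argument
(`IsSymmGraph.exists_eq_add`).

The lower bounds come from completing the square if `T* = T`, from pairing with `(a - T)x` if `T* =
-T`, and from factoring over a complexification if `T` is an isometry. For bounded normal `T`, each
`Δ_q(T)` is normal, so it and its adjoint have equal norms on every vector. If `T` is both anti
self-adjoint and unitary, then `T² = -I`, and `Δ_q(T) = 0` on the unit imaginary sphere. -/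

namespace QuatOp

/-! ### Reduction to a real Hilbert space. -/

section RealStructure

variable {H : Type*} [NormedAddCommGroup H] [Module ℍᵐᵒᵖ H] [QuaternionicInnerProductSpace H]

/-- The real inner product `Re ⟪u, v⟫` on a quaternionic inner product space. -/
@[reducible] noncomputable def realInnerProductSpace : InnerProductSpace ℝ H :=
  letI : Module ℝ H := Module.compHom H (algebraMap ℝ ℍᵐᵒᵖ)
  have smul_def : ∀ (r : ℝ) (x : H), r • x = MulOpposite.op (r : ℍ) • x := fun _ _ => rfl
  have self : ∀ x : H, ‖x‖ ^ 2 = (inner ℍ x x).re := fun x => by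
    rw [QuaternionicInnerProductSpace.inner_self, Quaternion.re_coe]
  { norm_smul_le := fun r x => by
      refine (sq_le_sq₀ (norm_nonneg _) (by positivity)).mp ?_
      rw [self, smul_def, inner_smul_left, QuaternionicInnerProductSpace.inner_smul_right,
        QuaternionicInnerProductSpace.inner_self, mul_pow, Real.norm_eq_abs, sq_abs]
      simp only [Quaternion.star_coe, ← Quaternion.coe_mul, Quaternion.re_coe]
      exact le_of_eq (by ring)
    inner := fun x y => (inner ℍ x y).re
    norm_sq_eq_re_inner := self
    conj_inner_symm := fun x y => by
      rw [← QuaternionicInnerProductSpace.star_inner x y]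
      simp
    add_left := fun x y z => by simp [inner_add_left]
    smul_left := fun x y r => by
      rw [smul_def, inner_smul_left]
      simp }

attribute [local instance] realInnerProductSpace

theorem real_inner_def (x y : H) : inner ℝ x y = (inner ℍ x y).re := rfl

theorem real_smul_def (r : ℝ) (x : H) : r • x = MulOpposite.op (r : ℍ) • x := rfl

/-- Lets quaternionic subspaces, graphs in particular, be viewed as real ones. -/
instance isScalarTower_real : IsScalarTower ℝ ℍᵐᵒᵖ H where
  smul_assoc r q x := by
    rw [real_smul_def, ← mul_smul, Algebra.smul_def]
    rfl

theorem real_inner_smul_op_right (x y : H) (q : ℍ) :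
    inner ℝ x (MulOpposite.op q • y) = (inner ℍ x y * q).re := by
  rw [real_inner_def, QuaternionicInnerProductSpace.inner_smul_right]

/-- A quaternion whose right multiples all have real part zero vanishes. -/
theorem eq_zero_of_re_mul {p : ℍ} (h : ∀ q : ℍ, (p * q).re = 0) : p = 0 := by
  have := h (star p)
  rw [Quaternion.self_mul_star, Quaternion.re_coe] at this
  exact Quaternion.normSq_eq_zero.mp this

/-- The graph of `T` is stable under right multiplication, so testing real parts on all `(xq, yq)`
recovers the full quaternionic identity. -/
theorem mem_adjointGraph_iff (T : H →ₗ.[ℍᵐᵒᵖ] H) (u w : H) :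
    (u, w) ∈ adjointGraph T ↔ ∀ x y, (x, y) ∈ T.graph → inner ℝ w x = inner ℝ u y := by
  constructor
  · intro h x y hxy
    obtain ⟨v, rfl, rfl⟩ := T.mem_graph_iff.mp hxy
    rw [real_inner_def, real_inner_def, h v]
  · intro h v
    refine sub_eq_zero.mp (eq_zero_of_re_mul fun q => ?_)
    have := h _ _ (T.graph.smul_mem (MulOpposite.op q) (T.mem_graph v))
    rw [real_inner_smul_op_right, real_inner_smul_op_right] at this
    rw [sub_mul, Quaternion.re_sub]
    exact sub_eq_zero.mpr this

theorem mem_graph_adjoint_iff {T : H →ₗ.[ℍᵐᵒᵖ] H} (hT : Dense (T.domain : Set H)) (u w : H) :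
    (u, w) ∈ (adjoint T).graph ↔ ∀ x y, (x, y) ∈ T.graph → inner ℝ w x = inner ℝ u y := by
  rw [← mem_adjointGraph_iff, adjoint, Submodule.toLinearPMap_graph_eq]
  rintro ⟨x, y⟩ hxy (rfl : x = 0)
  refine eq_zero_of_dense hT fun v hv => ?_
  have h := hxy ⟨v, hv⟩
  rw [← QuaternionicInnerProductSpace.star_inner (0 : H), inner_zero_right, star_zero] at h
  exact h

variable [CompleteSpace H]

theorem dense_iff_orthogonal (K : Submodule ℍᵐᵒᵖ H) :
    Dense (K : Set H) ↔ ∀ y : H, (∀ k ∈ K, inner ℝ k y = 0) → y = 0 := by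
  have h := (K.restrictScalars ℝ).topologicalClosure_eq_top_iff (𝕜 := ℝ)
  rw [← Submodule.dense_iff_topologicalClosure_eq_top, Submodule.eq_bot_iff] at h
  simpa [Submodule.mem_orthogonal] using h

end RealStructure

/-! ### Operators, spectra and `Δ_q` in terms of graphs. -/

section Graph

variable {H : Type*} [NormedAddCommGroup H] [Module ℍᵐᵒᵖ H]

theorem mem_graph_mul (S T : H →ₗ.[ℍᵐᵒᵖ] H) (x y : H) :
    (x, y) ∈ (mul S T).graph ↔ ∃ z, (x, z) ∈ T.graph ∧ (z, y) ∈ S.graph := by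
  constructor
  · intro h
    obtain ⟨⟨v, hv, hv'⟩, rfl, rfl⟩ := (mul S T).mem_graph_iff.mp h
    exact ⟨_, T.mem_graph ⟨v, hv⟩, S.mem_graph ⟨_, hv'⟩⟩
  · rintro ⟨z, h₁, h₂⟩
    obtain ⟨⟨v, hv⟩, rfl, rfl⟩ := T.mem_graph_iff.mp h₁
    obtain ⟨⟨w, hw⟩, h, rfl⟩ := S.mem_graph_iff.mp h₂
    obtain rfl : w = T ⟨v, hv⟩ := h
    exact (mul S T).mem_graph ⟨v, hv, hw⟩

theorem mem_graph_neg (A : H →ₗ.[ℍᵐᵒᵖ] H) (x y : H) :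
    (x, y) ∈ (-A).graph ↔ (x, -y) ∈ A.graph := by
  have h : ∀ (B : H →ₗ.[ℍᵐᵒᵖ] H) (y : H), (x, y) ∈ B.graph → (x, -y) ∈ (-B).graph := by
    intro B y hy
    obtain ⟨v, rfl, rfl⟩ := B.mem_graph_iff.mp hy
    exact (-B).mem_graph v
  exact ⟨fun hxy => by simpa using h _ _ hxy, fun hxy => by simpa using h _ _ hxy⟩

theorem mem_graph_one (x y : H) : (x, y) ∈ (one : H →ₗ.[ℍᵐᵒᵖ] H).graph ↔ y = x := by
  rw [LinearPMap.mem_graph_iff]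
  constructor
  · rintro ⟨v, rfl, rfl⟩
    rfl
  · rintro rfl
    exact ⟨⟨y, Submodule.mem_top⟩, rfl, rfl⟩

theorem ker_eq_bot_iff (A : H →ₗ.[ℍᵐᵒᵖ] H) :
    ker A = ⊥ ↔ ∀ x, (x, (0 : H)) ∈ A.graph → x = 0 := by
  rw [ker, LinearMap.ker_eq_bot']
  constructor
  · intro h x hx
    obtain ⟨v, rfl, hv⟩ := A.mem_graph_iff.mp hx
    simpa using h v hv
  · intro h v hv
    refine Subtype.ext (h _ ?_)
    have := A.mem_graph v
    rwa [show A v = 0 from hv] at this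

theorem mem_ran_iff (A : H →ₗ.[ℍᵐᵒᵖ] H) (y : H) : y ∈ ran A ↔ ∃ x, (x, y) ∈ A.graph :=
  A.mem_range_iff

theorem isBdd_inverse_iff {A : H →ₗ.[ℍᵐᵒᵖ] H} (hA : ker A = ⊥) :
    IsBdd A.inverse ↔ ∃ K : ℝ, ∀ x y, (x, y) ∈ A.graph → ‖x‖ ≤ K * ‖y‖ := by
  constructor
  · rintro ⟨K, hK⟩
    refine ⟨K, fun x y h => ?_⟩
    obtain ⟨v, rfl, rfl⟩ := A.mem_graph_iff.mp h
    have h₁ := hK ⟨A v, by rw [LinearPMap.inverse_domain]; exact ⟨v, rfl⟩⟩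
    rwa [LinearPMap.inverse_apply_eq hA (x := v) rfl] at h₁
  · rintro ⟨K, hK⟩
    refine ⟨K, fun u => ?_⟩
    obtain ⟨v, hv⟩ := A.inverse_domain.le u.2
    rw [LinearPMap.inverse_apply_eq hA (x := v) hv]
    have := hK _ _ (A.mem_graph v)
    rwa [show A v = u from hv] at this

/-- An operator that is bounded below has trivial kernel. -/
theorem ker_eq_bot_of_bound {A : H →ₗ.[ℍᵐᵒᵖ] H} {K : ℝ}
    (hK : ∀ x y, (x, y) ∈ A.graph → ‖x‖ ≤ K * ‖y‖) : ker A = ⊥ :=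
  (ker_eq_bot_iff A).mpr fun x hx => by simpa using hK x 0 hx

theorem residualSpectrum_eq_empty_iff (T : H →ₗ.[ℍᵐᵒᵖ] H) :
    residualSpectrum T = ∅ ↔
      ∀ q, ker (delta T q) = ⊥ → Dense (ran (delta T q) : Set H) := by
  simp only [residualSpectrum, Set.eq_empty_iff_forall_notMem, Set.mem_ofPred_eq, not_and, not_not,
    dense_iff_closure_eq]

theorem mem_continuousSpectrum_iff {T : H →ₗ.[ℍᵐᵒᵖ] H} (hr : residualSpectrum T = ∅) (q : ℍ) :
    q ∈ continuousSpectrum T ↔ ker (delta T q) = ⊥ ∧ ¬ IsBdd (delta T q).inverse := by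
  refine and_congr_right fun hker => and_iff_right ?_
  exact ((residualSpectrum_eq_empty_iff T).mp hr q hker).closure_eq

/-- If the residual spectrum is empty, then the points at which `Δ_q(T)` is bounded below belong to
the resolvent set. -/
theorem mem_resolventSet_of_bound {T : H →ₗ.[ℍᵐᵒᵖ] H} (hT : residualSpectrum T = ∅) {q : ℍ} {K : ℝ}
    (hK : ∀ x y, (x, y) ∈ (delta T q).graph → ‖x‖ ≤ K * ‖y‖) : q ∈ resolventSet T :=
  have hker := ker_eq_bot_of_bound hK
  ⟨hker, (residualSpectrum_eq_empty_iff T).mp hT q hker, (isBdd_inverse_iff hker).mpr ⟨K, hK⟩⟩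

theorem pointSpectrum_subset_spectrum (T : H →ₗ.[ℍᵐᵒᵖ] H) : pointSpectrum T ⊆ spectrum T :=
  fun _ hq hq' => hq hq'.1

variable [QuaternionicInnerProductSpace H]

attribute [local instance] realInnerProductSpace

theorem mem_graph_delta (T : H →ₗ.[ℍᵐᵒᵖ] H) (q : ℍ) (x y : H) :
    (x, y) ∈ (delta T q).graph ↔ ∃ x₁ x₂, (x, x₁) ∈ T.graph ∧ (x₁, x₂) ∈ T.graph ∧
      y = x₂ - (2 * q.re) • x₁ + ‖q‖ ^ 2 • x := by
  have hq : q + star q = ((2 * q.re : ℝ) : ℍ) := Quaternion.self_add_star' q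
  simp only [real_smul_def, ← hq]
  constructor
  · intro h
    obtain ⟨⟨v, hv, hv'⟩, rfl, rfl⟩ := (delta T q).mem_graph_iff.mp h
    exact ⟨_, _, T.mem_graph ⟨v, hv⟩, T.mem_graph ⟨_, hv'⟩, rfl⟩
  · rintro ⟨x₁, x₂, h₁, h₂, rfl⟩
    obtain ⟨⟨v, hv⟩, rfl, rfl⟩ := T.mem_graph_iff.mp h₁
    obtain ⟨⟨w, hw⟩, h, rfl⟩ := T.mem_graph_iff.mp h₂
    obtain rfl : w = T ⟨v, hv⟩ := h
    exact (delta T q).mem_graph ⟨v, hv, hw⟩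

end Graph

/-! ### Quadratic polynomials in a real operator with `T* = εT`. -/

section HilbertGraph

variable {E : Type*} [NormedAddCommGroup E] [InnerProductSpace ℝ E]

/-- A graph that is, up to the sign `ε`, equal to the graph of its adjoint: `ε = 1` for self-adjoint
and `ε = -1` for anti self-adjoint operators. -/
def IsSymmGraph (ε : ℝ) (G : Submodule ℝ (E × E)) : Prop :=
  ∀ u w, (u, w) ∈ G ↔ ∀ x y, (x, y) ∈ G → inner ℝ w x = ε * inner ℝ u y

/-- The graph of `T² - 2 a T + c` on `D(T²)`, where `G` is the graph of `T`. -/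
def Quad (G : Submodule ℝ (E × E)) (a c : ℝ) (x y : E) : Prop :=
  ∃ x₁ x₂, (x, x₁) ∈ G ∧ (x₁, x₂) ∈ G ∧ y = x₂ - (2 * a) • x₁ + c • x

variable {G : Submodule ℝ (E × E)} {ε : ℝ}

/-- The graph of `s⁻¹ (T - a)`. -/
theorem IsSymmGraph.comap (hG : IsSymmGraph ε G) {a s : ℝ} (ha : ε * a = a) (hs : s ≠ 0) :
    IsSymmGraph ε (G.comap ((LinearMap.fst ℝ E E).prod
      (s • LinearMap.snd ℝ E E + a • LinearMap.fst ℝ E E))) := by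
  intro u w
  change (u, s • w + a • u) ∈ G ↔ ∀ x y, (x, s • y + a • x) ∈ G → _
  rw [hG]
  have key : ∀ x y : E, inner ℝ (s • w + a • u) x = ε * inner ℝ u (s • y + a • x) ↔
      inner ℝ w x = ε * inner ℝ u y := fun x y => by
    simp only [_root_.inner_add_left, inner_add_right, real_inner_smul_left, real_inner_smul_right]
    constructor
    · intro h
      exact mul_left_cancel₀ hs (by linear_combination h + inner ℝ u x * ha)
    · intro h
      linear_combination s * h - inner ℝ u x * ha
  constructor
  · intro h x y hxy
    exact (key x y).mp (h _ _ hxy)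
  · intro h x y hxy
    obtain ⟨z, rfl⟩ : ∃ z, y = s • z + a • x := ⟨s⁻¹ • (y - a • x), by
      rw [smul_inv_smul₀ hs, sub_add_cancel]⟩
    exact (key x z).mpr (h x z hxy)

/-- The domain `D(T²)` does not depend on the constant term, which may therefore be traded for a
more convenient one. -/
theorem Quad.shift {a c : ℝ} {x y : E} (h : Quad G a c x y) (c' : ℝ) :
    Quad G a c' x (y + (c' - c) • x) := by
  obtain ⟨x₁, x₂, h₁, h₂, rfl⟩ := h
  exact ⟨x₁, x₂, h₁, h₂, by module⟩

/-- Moving `T` across the inner product costs a factor `ε`: the square term is unchanged and the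
linear term changes by `ε`. -/
theorem IsSymmGraph.inner_quad (hG : IsSymmGraph ε G) (hε : ε * ε = 1) {a c : ℝ} {x y u w : E}
    (h : Quad G a c x y) (h' : Quad G (ε * a) c u w) : inner ℝ w x = inner ℝ u y := by
  obtain ⟨x₁, x₂, h₁, h₂, rfl⟩ := h
  obtain ⟨u₁, u₂, k₁, k₂, rfl⟩ := h'
  have e₁ := (hG u u₁).mp k₁ _ _ h₁
  have e₂ := (hG u₁ u₂).mp k₂ _ _ h₁
  have e₃ := (hG u u₁).mp k₁ _ _ h₂
  simp only [_root_.inner_add_left, inner_add_right, inner_sub_left, inner_sub_right,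
    real_inner_smul_left, real_inner_smul_right]
  linear_combination e₂ + ε * e₃ - 2 * ε * a * e₁ +
    (inner ℝ u x₂ - 2 * a * inner ℝ u x₁) * hε

/-- If `T² - 2 a T + c'` and its formal adjoint are surjective, then the orthogonal complement of
the range of `T² - 2 a T + c` is the kernel of the formal adjoint. -/
theorem IsSymmGraph.quad_zero_of_orthogonal (hG : IsSymmGraph ε G) (hε : ε * ε = 1) {a c c' : ℝ}
    (h₁ : ∀ h, ∃ x, Quad G a c' x h) (h₂ : ∀ h, ∃ x, Quad G (ε * a) c' x h) {k : E}
    (hk : ∀ x y, Quad G a c x y → inner ℝ k y = 0) : Quad G (ε * a) c k 0 := by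
  -- If `k` were known to lie in the domain and the kernel, it would solve this equation. Pairing a
  -- solution `x` with an arbitrary `g = (T² - 2aT + c')v` shows that `x = k`.
  obtain ⟨x, hx⟩ := h₂ ((c' - c) • k)
  have hxk : x = k := by
    refine ext_inner_right ℝ fun g => ?_
    obtain ⟨v, hv⟩ := h₁ g
    have e₁ := hG.inner_quad hε hv hx
    have e₂ := hk _ _ (hv.shift c)
    rw [real_inner_smul_left] at e₁
    rw [inner_add_right, real_inner_smul_right] at e₂
    linear_combination -e₁ - e₂
  subst hxk
  have := hx.shift c
  rwa [show (c' - c) • x + (c - c') • x = 0 by module] at this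

theorem norm_le_of_inner_bound {m : ℝ} (hm : 0 < m) {x z y : E}
    (hz : m * ‖z‖ ^ 2 ≤ inner ℝ z y) (hx : m * ‖x‖ ≤ ‖z‖) : ‖x‖ ≤ (m ^ 2)⁻¹ * ‖y‖ := by
  have h₁ : m * ‖z‖ ≤ ‖y‖ := by
    rcases (norm_nonneg z).eq_or_lt with h | h
    · rw [← h, mul_zero]; exact norm_nonneg y
    · have := real_inner_le_norm z y
      exact le_of_mul_le_mul_left (by linarith) h
  rw [le_inv_mul_iff₀ (by positivity)]
  nlinarith

/-- Completing the square: `⟪x, y⟫ = ‖(T - a)x‖² + (c - a²)‖x‖²`; then Cauchy–Schwarz. -/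
theorem IsSymmGraph.quad_bound_of_selfAdjoint (hG : IsSymmGraph 1 G) {a c : ℝ} {x y : E}
    (hc : a ^ 2 < c) (h : Quad G a c x y) : ‖x‖ ≤ (c - a ^ 2)⁻¹ * ‖y‖ := by
  obtain ⟨x₁, x₂, h₁, h₂, rfl⟩ := h
  have e₁ := (hG x x₁).mp h₁ _ _ h₂
  have hn : ‖x₁ - a • x‖ ^ 2 = inner ℝ x₁ x₁ - 2 * a * inner ℝ x x₁ + a ^ 2 * ‖x‖ ^ 2 := by
    rw [norm_sub_sq_real, real_inner_smul_right, norm_smul, mul_pow, Real.norm_eq_abs, sq_abs,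
      real_inner_self_eq_norm_sq, real_inner_comm]
    ring
  have hi := real_inner_le_norm x (x₂ - (2 * a) • x₁ + c • x)
  have hj : (c - a ^ 2) * ‖x‖ ^ 2 ≤ inner ℝ x (x₂ - (2 * a) • x₁ + c • x) := by
    rw [inner_add_right, inner_sub_right, real_inner_smul_right, real_inner_smul_right,
      real_inner_self_eq_norm_sq]
    nlinarith [sq_nonneg ‖x₁ - a • x‖]
  rw [le_inv_mul_iff₀ (by linarith)]
  rcases (norm_nonneg x).eq_or_lt with h | h
  · rw [← h, mul_zero]; exact norm_nonneg _
  · exact le_of_mul_le_mul_left (by linarith) h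

/-- Antisymmetry gives `⟪x, Tx⟫ = 0`, so `z = (a - T)x` satisfies `‖z‖² = a²‖x‖² + ‖Tx‖²` and `⟪z,
y⟫ = a(‖Tx‖² + c‖x‖²)`. Since `c ≥ a²`, this pairing dominates `|a|‖z‖²` in absolute value. -/
theorem IsSymmGraph.quad_bound_of_antiSelfAdjoint (hG : IsSymmGraph (-1) G) {a c : ℝ} {x y : E}
    (ha : a ≠ 0) (hc : a ^ 2 ≤ c) (h : Quad G a c x y) : ‖x‖ ≤ (a ^ 2)⁻¹ * ‖y‖ := by
  obtain ⟨x₁, x₂, h₁, h₂, rfl⟩ := h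
  have e₁ := (hG x x₁).mp h₁ _ _ h₂
  have e₂ := (hG x x₁).mp h₁ _ _ h₁
  have e₃ := (hG x₁ x₂).mp h₂ _ _ h₂
  have e₀ : inner ℝ x x₁ = 0 := by rw [real_inner_comm] at e₂; linarith
  have e₄ : inner ℝ x₁ x₂ = 0 := by rw [real_inner_comm] at e₃; linarith
  have hn : ‖a • x - x₁‖ ^ 2 = a ^ 2 * ‖x‖ ^ 2 + ‖x₁‖ ^ 2 := by
    rw [norm_sub_sq_real, real_inner_smul_left, norm_smul, mul_pow, Real.norm_eq_abs, sq_abs, e₀]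
    ring
  have hi : inner ℝ (a • x - x₁) (x₂ - (2 * a) • x₁ + c • x) =
      a * (‖x₁‖ ^ 2 + c * ‖x‖ ^ 2) := by
    simp only [inner_add_right, inner_sub_left, inner_sub_right,
      real_inner_smul_left, real_inner_smul_right, real_inner_self_eq_norm_sq] at e₁ ⊢
    rw [real_inner_comm x x₁, e₀, e₄]
    linear_combination a * e₁
  have hb : |a| * ‖x‖ ≤ ‖a • x - x₁‖ := by
    refine (sq_le_sq₀ (by positivity) (norm_nonneg _)).mp ?_
    rw [hn, mul_pow, sq_abs]
    nlinarith [sq_nonneg ‖x₁‖]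
  have hd : |a| * ‖a • x - x₁‖ ^ 2 ≤ |inner ℝ (a • x - x₁) (x₂ - (2 * a) • x₁ + c • x)| := by
    rw [hi, abs_mul, hn]
    refine mul_le_mul_of_nonneg_left (le_trans ?_ (le_abs_self _)) (abs_nonneg a)
    nlinarith [sq_nonneg ‖x‖]
  have ha' := abs_pos.mpr ha
  rw [← sq_abs a]
  rcases abs_choice (inner ℝ (a • x - x₁) (x₂ - (2 * a) • x₁ + c • x)) with h | h
  · exact norm_le_of_inner_bound ha' (by rwa [h] at hd) hb
  · rw [← norm_neg (x₂ - (2 * a) • x₁ + c • x)]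
    exact norm_le_of_inner_bound ha' (by rwa [h, ← inner_neg_right] at hd) hb

variable [CompleteSpace E]

/-- Orthogonal projection of `(h, 0)` onto the graph (von Neumann). -/
theorem IsSymmGraph.exists_eq_add (hG : IsSymmGraph ε G) (hε : ε * ε = 1) (h : E) :
    ∃ x y z, (x, y) ∈ G ∧ (y, z) ∈ G ∧ h = x + ε • z := by
  let K : Submodule ℝ (WithLp 2 (E × E)) := G.comap (WithLp.linearEquiv 2 ℝ (E × E)).toLinearMap
  have hmem : ∀ p, p ∈ K ↔ (p.fst, p.snd) ∈ G := fun p => Iff.rfl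
  have hclosed : IsClosed (K : Set (WithLp 2 (E × E))) := by
    have : (K : Set (WithLp 2 (E × E))) =
        ⋂ p ∈ G, {k | inner ℝ k.snd p.1 = ε * inner ℝ k.fst p.2} := by
      ext k
      simp only [SetLike.mem_coe, hmem, Set.mem_iInter, Set.mem_ofPred_eq, Prod.forall]
      exact hG _ _
    rw [this]
    refine isClosed_biInter fun p _ => isClosed_eq ?_ ?_
    · exact (WithLp.continuous_snd 2 E E).inner continuous_const
    · exact continuous_const.mul ((WithLp.continuous_fst 2 E E).inner continuous_const)
  have : CompleteSpace K := hclosed.completeSpace_coe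
  obtain ⟨g, hg, g', hg', hsum⟩ := K.exists_add_mem_mem_orthogonal (WithLp.toLp 2 (h, (0 : E)))
  have h₁ : h = g.fst + g'.fst := congrArg WithLp.fst hsum
  have h₂ : 0 = g.snd + g'.snd := congrArg WithLp.snd hsum
  -- With projection `(x, y)`, the remainder `(h - x, -y)` is orthogonal to the graph. This says
  -- `T*y = h - x`, that is `Ty = ε(h - x)`.
  refine ⟨g.fst, g.snd, ε • (h - g.fst), hg, ?_, ?_⟩
  · rw [hG]
    intro x y hxy
    have := (K.mem_orthogonal _).mp hg' (WithLp.toLp 2 (x, y)) hxy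
    rw [WithLp.prod_inner_apply] at this
    change inner ℝ x g'.fst + inner ℝ y g'.snd = 0 at this
    rw [eq_sub_of_add_eq' h₁.symm, eq_neg_of_add_eq_zero_right h₂.symm, inner_neg_right,
      real_inner_comm, real_inner_comm g.snd] at this
    rw [real_inner_smul_left]
    linear_combination ε * this
  · rw [smul_smul, hε, one_smul, add_sub_cancel]

/-- For `S = s⁻¹(T - a)` the operator `I + εS²` is onto, and `εs²` times it is `(T - a)² + εs²`. -/
theorem IsSymmGraph.exists_quad (hG : IsSymmGraph ε G) (hε : ε * ε = 1) {a s : ℝ}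
    (ha : ε * a = a) (hs : s ≠ 0) (h : E) : ∃ x, Quad G a (a ^ 2 + ε * s ^ 2) x h := by
  obtain ⟨x, y, z, hxy, hyz, heq⟩ :=
    (hG.comap ha hs).exists_eq_add hε ((ε * (s ^ 2)⁻¹) • h)
  change (x, s • y + a • x) ∈ G at hxy
  change (y, s • z + a • y) ∈ G at hyz
  refine ⟨x, s • y + a • x, s • (s • z + a • y) + a • (s • y + a • x), hxy,
    G.add_mem (G.smul_mem s hyz) (G.smul_mem a hxy), ?_⟩
  have e : h = (ε * s ^ 2) • x + s ^ 2 • z := by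
    have := congrArg ((ε * s ^ 2) • ·) heq
    simp only [smul_smul, smul_add] at this
    rw [show ε * s ^ 2 * (ε * (s ^ 2)⁻¹) = 1 by field_simp; linear_combination hε, one_smul,
      show ε * s ^ 2 * ε = s ^ 2 by linear_combination s ^ 2 * hε] at this
    exact this
  rw [e]
  module

/-- Since `T² - α² = (T - α)(T + α)` is onto, so is its left factor. -/
theorem IsSymmGraph.exists_sub_smul (hG : IsSymmGraph (-1) G) {α : ℝ} (hα : α ≠ 0) (h : E) :
    ∃ x y, (x, y) ∈ G ∧ h = y - α • x := by
  obtain ⟨x, x₁, x₂, h₁, h₂, rfl⟩ := hG.exists_quad (by norm_num) (a := 0) (by norm_num) hα h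
  exact ⟨x₁ + α • x, x₂ + α • x₁, G.add_mem h₂ (G.smul_mem α h₁), by module⟩

/-- The constant `-1` makes `t² - 2at - 1` split over the reals for every `a`, into roots `a ± √(a²
+ 1)` whose product `-1` keeps both nonzero. Each linear factor of the operator is then onto. -/
theorem IsSymmGraph.exists_quad_neg_one (hG : IsSymmGraph (-1) G) (a : ℝ) (h : E) :
    ∃ x, Quad G a (-1) x h := by
  set s := √(a ^ 2 + 1)
  have hs : s ^ 2 = a ^ 2 + 1 := Real.sq_sqrt (by positivity)
  have hp : (a + s) * (a - s) = -1 := by linear_combination -hs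
  obtain ⟨z, z₁, hz, rfl⟩ := hG.exists_sub_smul (α := a + s) (fun h => by simp [h] at hp) h
  obtain ⟨w, w₁, hw, rfl⟩ := hG.exists_sub_smul (α := a - s) (fun h => by simp [h] at hp) z
  refine ⟨w, w₁, z₁ + (a - s) • w₁, hw, ?_, ?_⟩
  · have := G.add_mem hz (G.smul_mem (a - s) hw)
    simpa using this
  · rw [← hp]
    module

theorem IsSymmGraph.quad_zero_of_orthogonal_selfAdjoint (hG : IsSymmGraph 1 G) {a c : ℝ} {k : E}
    (hk : ∀ x y, Quad G a c x y → inner ℝ k y = 0) : Quad G a c k 0 := by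
  have := hG.exists_quad (by norm_num) (one_mul a) one_ne_zero
  simpa using hG.quad_zero_of_orthogonal (by norm_num) this (by simpa using this) hk

theorem IsSymmGraph.quad_zero_of_orthogonal_antiSelfAdjoint (hG : IsSymmGraph (-1) G) {a c : ℝ}
    {k : E} (hk : ∀ x y, Quad G a c x y → inner ℝ k y = 0) : Quad G (-a) c k 0 := by
  simpa using hG.quad_zero_of_orthogonal (by norm_num) (hG.exists_quad_neg_one a)
    (hG.exists_quad_neg_one _) hk

end HilbertGraph

/-! ### Self-adjoint and anti self-adjoint operators, possibly unbounded. -/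

section SelfAdjoint

variable {H : Type*} [NormedAddCommGroup H] [Module ℍᵐᵒᵖ H] [QuaternionicInnerProductSpace H]

attribute [local instance] realInnerProductSpace

theorem mem_graph_delta_iff_quad (T : H →ₗ.[ℍᵐᵒᵖ] H) (q : ℍ) (x y : H) :
    (x, y) ∈ (delta T q).graph ↔ Quad (T.graph.restrictScalars ℝ) q.re (‖q‖ ^ 2) x y :=
  mem_graph_delta T q x y

theorem IsSelfAdjoint.isSymmGraph {T : H →ₗ.[ℍᵐᵒᵖ] H} (hT : Dense (T.domain : Set H))
    (h : IsSelfAdjoint T) : IsSymmGraph 1 (T.graph.restrictScalars ℝ) := by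
  intro u w
  have := mem_graph_adjoint_iff hT u w
  rw [← show T = adjoint T from h] at this
  simpa using this

theorem IsAntiSelfAdjoint.isSymmGraph {T : H →ₗ.[ℍᵐᵒᵖ] H} (hT : Dense (T.domain : Set H))
    (h : IsAntiSelfAdjoint T) : IsSymmGraph (-1) (T.graph.restrictScalars ℝ) := by
  intro u w
  have := mem_graph_adjoint_iff hT u (-w)
  rw [← mem_graph_neg, ← show T = -adjoint T from h] at this
  simpa [neg_eq_iff_eq_neg] using this

theorem sq_re_add_sq_norm_im (q : ℍ) : ‖q‖ ^ 2 = q.re ^ 2 + ‖q.im‖ ^ 2 := by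
  simp only [sq, ← Quaternion.normSq_eq_norm_mul_self, Quaternion.normSq_def']
  simp
  ring

variable [CompleteSpace H] {T : H →ₗ.[ℍᵐᵒᵖ] H}

theorem dense_ran_iff (A : H →ₗ.[ℍᵐᵒᵖ] H) : Dense (ran A : Set H) ↔
    ∀ k : H, (∀ x y, (x, y) ∈ A.graph → inner ℝ k y = 0) → k = 0 := by
  rw [dense_iff_orthogonal]
  simp only [mem_ran_iff, forall_exists_index]
  refine forall_congr' fun k => ?_
  rw [forall_comm]
  simp only [real_inner_comm]

theorem IsSelfAdjoint.residualSpectrum_eq_empty (hT : Dense (T.domain : Set H))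
    (h : IsSelfAdjoint T) : residualSpectrum T = ∅ := by
  rw [residualSpectrum_eq_empty_iff]
  intro q hker
  simp only [ker_eq_bot_iff, dense_ran_iff, mem_graph_delta_iff_quad] at hker ⊢
  exact fun k hk => hker k ((h.isSymmGraph hT).quad_zero_of_orthogonal_selfAdjoint hk)

theorem IsAntiSelfAdjoint.residualSpectrum_eq_empty (hT : Dense (T.domain : Set H))
    (h : IsAntiSelfAdjoint T) : residualSpectrum T = ∅ := by
  rw [residualSpectrum_eq_empty_iff]
  intro q hker
  simp only [ker_eq_bot_iff, dense_ran_iff, mem_graph_delta_iff_quad] at hker ⊢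
  intro k hk
  have hG := h.isSymmGraph hT
  have h₀ := hG.quad_zero_of_orthogonal_antiSelfAdjoint hk
  -- The formal adjoint has linear coefficient `-Re q`. If `Re q = 0` it is `Δ_q(T)` itself,
  -- injective by assumption; otherwise it is bounded below.
  by_cases ha : q.re = 0
  · rw [ha, neg_zero, ← ha] at h₀
    exact hker k h₀
  · have := hG.quad_bound_of_antiSelfAdjoint (neg_ne_zero.mpr ha)
      (by rw [sq_re_add_sq_norm_im]; nlinarith [sq_nonneg ‖q.im‖]) h₀
    simpa using this

theorem IsSelfAdjoint.spectrum_subset (hT : Dense (T.domain : Set H))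
    (h : IsSelfAdjoint T) : spectrum T ⊆ real := by
  intro q hq
  by_contra hr
  have him : q.im ≠ 0 := fun h₀ => hr ⟨q.re, by conv_rhs => rw [← q.re_add_im, h₀, add_zero]⟩
  have hpos := norm_pos_iff.mpr him
  refine hq (mem_resolventSet_of_bound (h.residualSpectrum_eq_empty hT) fun x y hxy =>
    (h.isSymmGraph hT).quad_bound_of_selfAdjoint ?_ ((mem_graph_delta_iff_quad T q x y).mp hxy))
  rw [sq_re_add_sq_norm_im]
  nlinarith

theorem IsAntiSelfAdjoint.spectrum_subset (hT : Dense (T.domain : Set H))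
    (h : IsAntiSelfAdjoint T) : spectrum T ⊆ imaginary := by
  intro q hq
  by_contra hr
  have hre : q.re ≠ 0 := fun h₀ => hr (by
    change q = q.im
    conv_lhs => rw [← q.re_add_im, h₀, Quaternion.coe_zero, zero_add])
  refine hq (mem_resolventSet_of_bound (h.residualSpectrum_eq_empty hT) fun x y hxy =>
    (h.isSymmGraph hT).quad_bound_of_antiSelfAdjoint hre ?_
      ((mem_graph_delta_iff_quad T q x y).mp hxy))
  rw [sq_re_add_sq_norm_im]
  nlinarith [sq_nonneg ‖q.im‖]

end SelfAdjoint

/-! ### Quadratic polynomials in bounded operators. -/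

section Polynomial

variable {E : Type*} [NormedAddCommGroup E] [InnerProductSpace ℝ E]

/-- The operator `L² - 2 a L + c`. -/
noncomputable def quadCLM (L : E →L[ℝ] E) (a c : ℝ) : E →L[ℝ] E :=
  L * L - (2 * a) • L + c • (1 : E →L[ℝ] E)

theorem quadCLM_apply (L : E →L[ℝ] E) (a c : ℝ) (x : E) :
    quadCLM L a c x = L (L x) - (2 * a) • L x + c • x := rfl

theorem commute_quadCLM {S L : E →L[ℝ] E} (h : Commute S L) (a c : ℝ) :
    Commute S (quadCLM L a c) :=
  ((h.mul_right h).sub_right (h.smul_right _)).add_right ((Commute.one_right _).smul_right _)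

theorem adjoint_quadCLM [CompleteSpace E] (L : E →L[ℝ] E) (a c : ℝ) :
    (quadCLM L a c).adjoint = quadCLM L.adjoint a c := by
  simp [quadCLM, ← ContinuousLinearMap.star_eq_adjoint]

/-- A real polynomial in a normal operator is normal, and a normal operator and its adjoint have
equal norms on each vector. -/
theorem norm_quadCLM_adjoint_apply [CompleteSpace E] {L : E →L[ℝ] E}
    (h : Commute L.adjoint L) (a c : ℝ) (x : E) :
    ‖quadCLM L.adjoint a c x‖ = ‖quadCLM L a c x‖ := by
  have hstar : IsStarNormal (quadCLM L a c) := ⟨by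
    rw [ContinuousLinearMap.star_eq_adjoint, adjoint_quadCLM]
    exact commute_quadCLM (commute_quadCLM h.symm a c).symm a c⟩
  rw [← adjoint_quadCLM]
  exact ((ContinuousLinearMap.isStarNormal_iff_norm_eq_adjoint).mp hstar x).symm

/-- For an isometry `L`, the operator `(L - a)² + b²` is bounded below unless `a² + b² = 1`: it is the
product of the operators `L - (a ± b J)` on `E × E`, where `J` is the standard complex structure. -/
theorem norm_quadCLM_ge_of_isometry {L : E →L[ℝ] E} (hL : ∀ x, ‖L x‖ = ‖x‖) {a b r : ℝ}
    (hr : 0 ≤ r) (h : r ^ 2 = a ^ 2 + b ^ 2) (x : E) :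
    (1 - r) ^ 2 * ‖x‖ ≤ ‖quadCLM L a (r ^ 2) x‖ := by
  -- With `J(u, v) = (-v, u)` and `L` acting diagonally, `z = (L - a + bJ)(x, 0)`, `U = Lz` and `V =
  -- (a + bJ)z`. Thus `U - V` is the full product applied to `(x, 0)`, while `‖U‖ = ‖z‖` and `‖V‖ =
  -- r‖z‖`; the reverse triangle inequality gives one factor `|1 - r|`.
  set z₁ := L x - a • x with hz₁
  set z₂ := b • x with hz₂
  set z : WithLp 2 (E × E) := WithLp.toLp 2 (z₁, z₂)
  set U : WithLp 2 (E × E) := WithLp.toLp 2 (L z₁, L z₂)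
  set V : WithLp 2 (E × E) := WithLp.toLp 2 (a • z₁ - b • z₂, a • z₂ + b • z₁)
  have hz : ‖z‖ ^ 2 = ‖z₁‖ ^ 2 + ‖z₂‖ ^ 2 := WithLp.prod_norm_sq_eq_of_L2 z
  have hU : ‖U‖ = ‖z‖ := by
    refine (sq_eq_sq₀ (norm_nonneg _) (norm_nonneg _)).mp ?_
    rw [hz, WithLp.prod_norm_sq_eq_of_L2]
    change ‖L z₁‖ ^ 2 + ‖L z₂‖ ^ 2 = _
    rw [hL, hL]
  have hV : ‖V‖ = r * ‖z‖ := by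
    refine (sq_eq_sq₀ (norm_nonneg _) (by positivity)).mp ?_
    rw [mul_pow, hz, WithLp.prod_norm_sq_eq_of_L2, h]
    change ‖a • z₁ - b • z₂‖ ^ 2 + ‖a • z₂ + b • z₁‖ ^ 2 = _
    rw [norm_sub_sq_real, norm_add_sq_real]
    simp only [norm_smul, mul_pow, Real.norm_eq_abs, sq_abs, real_inner_smul_left,
      real_inner_smul_right]
    rw [real_inner_comm z₁ z₂]
    ring
  have hUV : ‖U - V‖ = ‖quadCLM L a (r ^ 2) x‖ := by
    have : U - V = WithLp.toLp 2 (quadCLM L a (r ^ 2) x, 0) := by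
      rw [← WithLp.toLp_sub, Prod.mk_sub_mk]
      congr 2
      · rw [quadCLM_apply, hz₁, hz₂, map_sub, map_smul, h]
        module
      · rw [hz₁, hz₂, map_smul]
        module
    rw [this]
    refine (sq_eq_sq₀ (norm_nonneg _) (norm_nonneg _)).mp ?_
    rw [WithLp.prod_norm_sq_eq_of_L2]
    simp
  have h₁ : |1 - r| * ‖z‖ ≤ ‖quadCLM L a (r ^ 2) x‖ := by
    have := abs_norm_sub_norm_le U V
    rwa [hUV, hU, hV, show ‖z‖ - r * ‖z‖ = (1 - r) * ‖z‖ by ring, abs_mul, abs_norm] at this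
  have ha : |a| ≤ r := abs_le_of_sq_le_sq (by nlinarith [sq_nonneg b]) hr
  -- The second factor `|1 - r|`: here `‖z‖² = (1 + r²)‖x‖² - 2a⟪Lx, x⟫`, and `|a| ≤ r`.
  have h₂ : |1 - r| * ‖x‖ ≤ ‖z‖ := by
    refine (sq_le_sq₀ (by positivity) (norm_nonneg _)).mp ?_
    rw [hz, hz₁, hz₂, norm_sub_sq_real, mul_pow, sq_abs]
    simp only [norm_smul, mul_pow, Real.norm_eq_abs, sq_abs, real_inner_smul_right, hL]
    have h₃ := abs_real_inner_le_norm (L x) x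
    rw [hL] at h₃
    have h₄ : a * inner ℝ (L x) x ≤ r * (‖x‖ * ‖x‖) :=
      (le_abs_self _).trans (by rw [abs_mul]; gcongr)
    linear_combination 2 * h₄ + ‖x‖ ^ 2 * h
  rw [← sq_abs]
  calc |1 - r| ^ 2 * ‖x‖ = |1 - r| * (|1 - r| * ‖x‖) := by ring
    _ ≤ |1 - r| * ‖z‖ := by gcongr
    _ ≤ _ := h₁

end Polynomial

/-! ### Bounded normal and unitary operators. -/

section Bounded

variable {H : Type*} [NormedAddCommGroup H] [Module ℍᵐᵒᵖ H] [QuaternionicInnerProductSpace H]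

attribute [local instance] realInnerProductSpace

/-- The real operator `L` has the same graph as `T`; in particular `T` is everywhere defined. -/
def HasCLM (T : H →ₗ.[ℍᵐᵒᵖ] H) (L : H →L[ℝ] H) : Prop := ∀ x y, (x, y) ∈ T.graph ↔ y = L x

theorem exists_hasCLM {T : H →ₗ.[ℍᵐᵒᵖ] H} (hT : T ∈ boundedOperators H) : ∃ L, HasCLM T L := by
  obtain ⟨htop, K, hK⟩ := hT
  have hdom : ∀ x, x ∈ T.domain := fun x => htop ▸ Submodule.mem_top
  let f : H →ₗ[ℝ] H :=
    { toFun := fun x => T ⟨x, hdom x⟩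
      map_add' := fun x y => T.map_add ⟨x, hdom x⟩ ⟨y, hdom y⟩
      map_smul' := fun r x => T.map_smul (MulOpposite.op (r : ℍ)) ⟨x, hdom x⟩ }
  refine ⟨f.mkContinuous K fun x => hK ⟨x, hdom x⟩, fun x y => ?_⟩
  rw [LinearPMap.mem_graph_iff]
  constructor
  · rintro ⟨v, rfl, rfl⟩
    rfl
  · rintro rfl
    exact ⟨⟨x, hdom x⟩, rfl, rfl⟩

variable {T : H →ₗ.[ℍᵐᵒᵖ] H} {L : H →L[ℝ] H}

theorem HasCLM.mem_graph_delta (h : HasCLM T L) (q : ℍ) (x y : H) :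
    (x, y) ∈ (delta T q).graph ↔ y = quadCLM L q.re (‖q‖ ^ 2) x := by
  rw [QuatOp.mem_graph_delta]
  simp only [h _ _, quadCLM_apply]
  simp

theorem HasCLM.ker_delta_eq_bot_iff (h : HasCLM T L) (q : ℍ) :
    ker (delta T q) = ⊥ ↔ ∀ x, quadCLM L q.re (‖q‖ ^ 2) x = 0 → x = 0 := by
  rw [ker_eq_bot_iff]
  simp only [h.mem_graph_delta, eq_comm (a := (0 : H))]

theorem HasCLM.isBdd_inverse_iff (h : HasCLM T L) {q : ℍ} (hker : ker (delta T q) = ⊥) :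
    IsBdd (delta T q).inverse ↔
      ∃ K : ℝ, ∀ x, ‖x‖ ≤ K * ‖quadCLM L q.re (‖q‖ ^ 2) x‖ := by
  simp [QuatOp.isBdd_inverse_iff hker, h.mem_graph_delta]

variable [CompleteSpace H]

theorem HasCLM.adjoint (hT : Dense (T.domain : Set H)) (h : HasCLM T L) :
    HasCLM (adjoint T) L.adjoint := by
  intro u w
  simp only [mem_graph_adjoint_iff hT, h _ _]
  constructor
  · intro hw
    refine ext_inner_right ℝ fun v => ?_
    rw [hw v _ rfl, ContinuousLinearMap.adjoint_inner_left]
  · rintro rfl x _ rfl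
    rw [ContinuousLinearMap.adjoint_inner_left]

theorem commute_of_mul_adjoint (hT : Dense (T.domain : Set H)) (h : HasCLM T L)
    (hn : mul T (adjoint T) = mul (adjoint T) T) : Commute L.adjoint L := by
  refine ContinuousLinearMap.ext fun x => ?_
  have h₁ : (x, L.adjoint (L x)) ∈ (mul (QuatOp.adjoint T) T).graph :=
    (mem_graph_mul _ _ _ _).mpr ⟨_, (h _ _).mpr rfl, (h.adjoint hT _ _).mpr rfl⟩
  rw [← hn, mem_graph_mul] at h₁
  obtain ⟨z, hz, hz'⟩ := h₁
  rw [h.adjoint hT _ _] at hz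
  rw [h _ _, hz] at hz'
  exact hz'

/-- A vector orthogonal to the range is killed by the adjoint of `Δ_q(T)`, hence by normality it
lies in the kernel of `Δ_q(T)`. -/
theorem HasCLM.residualSpectrum_eq_empty (h : HasCLM T L) (hn : Commute L.adjoint L) :
    residualSpectrum T = ∅ := by
  rw [residualSpectrum_eq_empty_iff]
  intro q hker
  rw [h.ker_delta_eq_bot_iff] at hker
  rw [dense_ran_iff]
  intro k hk
  refine hker k (norm_eq_zero.mp ?_)
  rw [← norm_quadCLM_adjoint_apply hn, norm_eq_zero, ← adjoint_quadCLM]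
  refine ext_inner_right ℝ fun v => ?_
  rw [ContinuousLinearMap.adjoint_inner_left, inner_zero_left]
  exact hk v _ ((h.mem_graph_delta q v _).mpr rfl)

theorem ker_delta_adjoint_eq_bot_iff (hT : Dense (T.domain : Set H)) (h : HasCLM T L)
    (hn : Commute L.adjoint L) (q : ℍ) :
    ker (delta (adjoint T) q) = ⊥ ↔ ker (delta T q) = ⊥ := by
  rw [(h.adjoint hT).ker_delta_eq_bot_iff, h.ker_delta_eq_bot_iff]
  refine forall_congr' fun x => ?_
  rw [← norm_eq_zero, norm_quadCLM_adjoint_apply hn, norm_eq_zero]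

theorem IsNormal.spectra (hT : Dense (T.domain : Set H)) (h : IsNormal T) :
    pointSpectrum T = pointSpectrum (adjoint T) ∧
      residualSpectrum T = ∅ ∧ residualSpectrum (adjoint T) = ∅ ∧
      continuousSpectrum T = continuousSpectrum (adjoint T) := by
  obtain ⟨L, hL⟩ := exists_hasCLM h.1
  have hL' := hL.adjoint hT
  have hn := commute_of_mul_adjoint hT hL h.2
  have hk := ker_delta_adjoint_eq_bot_iff hT hL hn
  have hr := hL.residualSpectrum_eq_empty hn
  have hr' := hL'.residualSpectrum_eq_empty (by
    rw [ContinuousLinearMap.adjoint_adjoint]; exact hn.symm)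
  refine ⟨Set.ext fun q => (hk q).not.symm, hr, hr', Set.ext fun q => ?_⟩
  rw [mem_continuousSpectrum_iff hr, mem_continuousSpectrum_iff hr', hk]
  refine and_congr_right fun hker => not_congr ?_
  rw [hL.isBdd_inverse_iff hker, hL'.isBdd_inverse_iff ((hk q).mpr hker)]
  simp only [norm_quadCLM_adjoint_apply hn]

theorem IsUnitary.adjoint_apply_self (hT : Dense (T.domain : Set H)) (h : IsUnitary T)
    (hL : HasCLM T L) (x : H) : L.adjoint (L x) = x := by
  have h₁ : (x, L.adjoint (L x)) ∈ (mul (QuatOp.adjoint T) T).graph :=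
    (mem_graph_mul _ _ _ _).mpr ⟨_, (hL _ _).mpr rfl, (hL.adjoint hT _ _).mpr rfl⟩
  rwa [h.2.2, mem_graph_one] at h₁

theorem IsUnitary.spectrum_subset (hT : Dense (T.domain : Set H)) (hb : T ∈ boundedOperators H)
    (h : IsUnitary T) : spectrum T ⊆ {q : ℍ | ‖q‖ = 1} := by
  obtain ⟨L, hL⟩ := exists_hasCLM hb
  have hn := commute_of_mul_adjoint hT hL (h.2.1.trans h.2.2.symm)
  have hiso : ∀ x, ‖L x‖ = ‖x‖ := fun x => by
    refine (sq_eq_sq₀ (norm_nonneg _) (norm_nonneg _)).mp ?_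
    rw [← real_inner_self_eq_norm_sq, ← ContinuousLinearMap.adjoint_inner_left,
      h.adjoint_apply_self hT hL, real_inner_self_eq_norm_sq]
  intro q hq
  by_contra hr
  have hpos : 0 < (1 - ‖q‖) ^ 2 := sq_pos_of_ne_zero (sub_ne_zero.mpr (Ne.symm hr))
  refine hq (mem_resolventSet_of_bound (K := ((1 - ‖q‖) ^ 2)⁻¹)
    (hL.residualSpectrum_eq_empty hn) fun x y hxy => ?_)
  rw [hL.mem_graph_delta] at hxy
  rw [le_inv_mul_iff₀ hpos, hxy]
  exact norm_quadCLM_ge_of_isometry hiso (norm_nonneg q) (sq_re_add_sq_norm_im q) x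

theorem IsAntiSelfAdjoint.unitSphere_subset_pointSpectrum [Nontrivial H]
    (hT : Dense (T.domain : Set H)) (hb : T ∈ boundedOperators H) (ha : IsAntiSelfAdjoint T)
    (h : IsUnitary T) : unitSphere ⊆ pointSpectrum T := by
  rintro q ⟨him, hq⟩ hker
  obtain ⟨L, hL⟩ := exists_hasCLM hb
  have hre : q.re = 0 := by
    have := congrArg QuaternionAlgebra.re (show q = q.im from him)
    simpa using this
  have hadj : ∀ x, L.adjoint x = -L x := fun x => by
    have h₁ : (x, L x) ∈ T.graph := (hL _ _).mpr rfl
    rw [show T = -adjoint T from ha, mem_graph_neg, hL.adjoint hT _ _] at h₁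
    exact h₁.symm
  obtain ⟨x, hx⟩ := exists_ne (0 : H)
  refine hx ((hL.ker_delta_eq_bot_iff q).mp hker x ?_)
  have h₂ := h.adjoint_apply_self hT hL x
  rw [hadj] at h₂
  rw [quadCLM_apply, hre, hq]
  -- The constant term `x` is rewritten as `T*Tx = -T²x`, which cancels the square term.
  nth_rw 3 [← h₂]
  module

theorem IsAntiSelfAdjoint.spectrum_eq_unitSphere [Nontrivial H]
    (hT : Dense (T.domain : Set H)) (hb : T ∈ boundedOperators H) (ha : IsAntiSelfAdjoint T)
    (h : IsUnitary T) : spectrum T = pointSpectrum T ∧ pointSpectrum T = unitSphere := by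
  have h₁ := ha.unitSphere_subset_pointSpectrum hT hb h
  have h₂ := pointSpectrum_subset_spectrum T
  have h₃ : spectrum T ⊆ unitSphere := fun q hq =>
    ⟨ha.spectrum_subset hT hq, h.spectrum_subset hT hb hq⟩
  exact ⟨(h₃.trans h₁).antisymm h₂, (h₂.trans h₃).antisymm h₁⟩

end Bounded

end QuatOp

theorem mainTheorem7 {H : Type*} [NormedAddCommGroup H] [Module ℍᵐᵒᵖ H]
    [QuaternionicInnerProductSpace H] [CompleteSpace H] [Nontrivial H]
    (T : H →ₗ.[ℍᵐᵒᵖ] H) (hT : Dense (T.domain : Set H)) :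
    (T ∈ QuatOp.boundedOperators H → QuatOp.IsNormal T →
      QuatOp.pointSpectrum T = QuatOp.pointSpectrum (QuatOp.adjoint T) ∧
      QuatOp.residualSpectrum T = ∅ ∧ QuatOp.residualSpectrum (QuatOp.adjoint T) = ∅ ∧
      QuatOp.continuousSpectrum T = QuatOp.continuousSpectrum (QuatOp.adjoint T)) ∧
    (QuatOp.IsSelfAdjoint T →
      QuatOp.spectrum T ⊆ QuatOp.real ∧ QuatOp.residualSpectrum T = ∅) ∧
    (QuatOp.IsAntiSelfAdjoint T →
      QuatOp.spectrum T ⊆ QuatOp.imaginary ∧ QuatOp.residualSpectrum T = ∅) ∧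
    (T ∈ QuatOp.boundedOperators H → QuatOp.IsUnitary T →
      QuatOp.spectrum T ⊆ {q : ℍ | ‖q‖ = 1}) ∧
    (T ∈ QuatOp.boundedOperators H → QuatOp.IsAntiSelfAdjoint T → QuatOp.IsUnitary T →
      QuatOp.spectrum T = QuatOp.pointSpectrum T ∧
      QuatOp.pointSpectrum T = QuatOp.unitSphere) :=
  ⟨fun _ h => h.spectra hT,
    fun h => ⟨h.spectrum_subset hT, h.residualSpectrum_eq_empty hT⟩,
    fun h => ⟨h.spectrum_subset hT, h.residualSpectrum_eq_empty hT⟩,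
    fun hb h => h.spectrum_subset hT hb,
    fun hb ha h => ha.spectrum_eq_unitSphere hT hb h⟩
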